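/- For $t\ge 1$, define the $t$-weight of a matrix $\mathbf v\in\mathbb F_2^{t\times n}$ as the number of its non-zero columns, and let $d^{(t)}(\mathbf v,\mathbf u)$ be the $t$-weight of $\mathbf v-\mathbf u$. For a binary linear code $C\subseteq\mathbb F_2^n$, the $t$-th generalized covering radius $R_t(C)$ is the smallest integer $\rho$ such that every $\mathbf v\in\mathbb F_2^{t\times n}$ is at $d^{(t)}$-distance at most $\rho$ from some matrix all of whose rows belong to $C$. For $0\le r\le m$, let $\mathrm{RM}(r,m)\subseteq\mathbb F_2^{2^m}$ be the $r$-th order binary Reed--Muller code: $\mathrm{RM}(0,m)=\{\overline 0,\overline 1\}$, $\mathrm{RM}(m,m)=\mathbb F_2^{2^m}$, and $\mathrm{RM}(r,m)=\{(\overline u,\overline u+\overline v) : \overline u\in \mathrm{RM}(r,m-1),\ \overline v\in \mathrm{RM}(r-1,m-1)\}$ for $1\le r\le m-1$. Write $R_t(r,m)=R_t(\mathrm{RM}(r,m))$, and let $H_2(x)=-x\log_2 x-(1-x)\log_2(1-x)$ be the binary entropy function. **Theorem.** Let $t\ge 1$ be an integer and let $0<\alpha\le\frac12$ be real. (i) For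 every integer $m\ge1$ such that $\alpha m$ is an integer, $$R_t(\alpha m,m)\ \le\ \Bigl(1-\frac1{2^t}\Bigr)2^m-\frac{\sqrt{2^t-1}}{2^t}\cdot\frac{1}{\sqrt{8m\alpha(1-\alpha)}}\cdot 2^{mH_2(\alpha)} .$$ (ii) If $\alpha<\frac12$, then for every integer $m\ge1$ such that $\alpha m$ is an integer, $$R_t(\alpha m,m)\ \ge\ \Bigl(1-\frac1{2^t}\Bigr)2^m-\frac{\sqrt{2t(2^t-1)\ln 2}}{2^t}\cdot 2^{\frac m2(1+H_2(\alpha))}\,(1+o(1)),$$ where $o(1)$ denotes a quantity that depends only on $t,\alpha,m$ and tends to $0$ as $m\to\infty$ with $t$ and $\alpha$ fixed. -/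

import Mathlib

open Filter Topology

/-- The `t`-weight of a `t × n` matrix with rows `v i`: the number of columns in the union of the
supports of its rows. -/
def tWeight {F ι : Type*} [Field F] [DecidableEq F] [Fintype ι] {t : ℕ}
    (v : Fin t → ι → F) : ℕ :=
  (Finset.univ.filter fun j : ι => ∃ i : Fin t, v i j ≠ 0).card

/-- The metric on `t × n` matrices induced by the `t`-weight. -/
def tDist {F ι : Type*} [Field F] [DecidableEq F] [Fintype ι] {t : ℕ}
    (v u : Fin t → ι → F) : ℕ :=
  tWeight (v - u)

/-- The `t`-th generalized covering radius of a linear code `C` of length `n = |ι|`: the least `r`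
such that the balls of radius `r` (for `tDist`) around the `t × n` matrices all of whose rows lie
in `C` cover the space of all `t × n` matrices. -/
noncomputable def genCoveringRadius {F ι : Type*} [Field F] [DecidableEq F] [Fintype ι]
    (t : ℕ) (C : Submodule F (ι → F)) : ℕ :=
  sInf {r : ℕ | ∀ v : Fin t → ι → F, ∃ c : Fin t → ι → F, (∀ i, c i ∈ C) ∧ tDist c v ≤ r}

/-- The set of admissible radii is non-empty, so the infimum above is a minimum. -/
theorem genCoveringRadius_spec {F ι : Type*} [Field F] [DecidableEq F] [Fintype ι]
    (t : ℕ) (C : Submodule F (ι → F)) (v : Fin t → ι → F) :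
    ∃ c : Fin t → ι → F, (∀ i, c i ∈ C) ∧ tDist c v ≤ genCoveringRadius t C := by
  have h : {r : ℕ | ∀ v : Fin t → ι → F, ∃ c : Fin t → ι → F,
      (∀ i, c i ∈ C) ∧ tDist c v ≤ r}.Nonempty :=
    ⟨Fintype.card ι, fun w => ⟨0, fun _ => C.zero_mem, Finset.card_le_univ _⟩⟩
  exact Nat.sInf_mem h v

/-- The `(u, u + v)` construction. A word of length `2 ^ (m + 1)` is a function on `𝔽₂^(m+1)`; its
first half is its restriction to the points with first coordinate `0`, its second half the
restriction to the points with first coordinate `1`. -/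
def uuvCode {m : ℕ} (C₁ C₂ : Submodule (ZMod 2) ((Fin m → ZMod 2) → ZMod 2)) :
    Submodule (ZMod 2) ((Fin (m + 1) → ZMod 2) → ZMod 2) where
  carrier := {c | ∃ u ∈ C₁, ∃ v ∈ C₂, ∀ x : Fin m → ZMod 2,
    c (Fin.cons 0 x) = u x ∧ c (Fin.cons 1 x) = u x + v x}
  zero_mem' := ⟨0, C₁.zero_mem, 0, C₂.zero_mem, fun x => by simp⟩
  add_mem' := by
    rintro a b ⟨u, hu, v, hv, h⟩ ⟨u', hu', v', hv', h'⟩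
    refine ⟨u + u', C₁.add_mem hu hu', v + v', C₂.add_mem hv hv', fun x => ?_⟩
    simp only [Pi.add_apply, (h x).1, (h x).2, (h' x).1, (h' x).2, true_and]
    ring
  smul_mem' := by
    rintro k a ⟨u, hu, v, hv, h⟩
    refine ⟨k • u, C₁.smul_mem k hu, k • v, C₂.smul_mem k hv, fun x => ?_⟩
    simp only [Pi.smul_apply, smul_eq_mul, (h x).1, (h x).2, true_and]
    ring

/-- The binary Reed-Muller code `RM(r, m)` of length `2 ^ m`, with positions indexed by `𝔽₂^m`:
`RM(0, m)` is the repetition code, `RM(m, m)` is the whole space, and for `1 ≤ r ≤ m - 1` the code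
`RM(r, m)` is obtained from `RM(r, m - 1)` and `RM(r - 1, m - 1)` by the `(u, u + v)` construction.
(By convention it is the whole space for `r > m`.) -/
def reedMuller : ℕ → (m : ℕ) → Submodule (ZMod 2) ((Fin m → ZMod 2) → ZMod 2)
  | 0, _ => Submodule.span (ZMod 2) {1}
  | _ + 1, 0 => ⊤
  | r + 1, m + 1 => if m ≤ r then ⊤ else uuvCode (reedMuller (r + 1) m) (reedMuller r m)

/-- `R_t(r, m)`, the `t`-th generalized covering radius of `RM(r, m)`. -/
noncomputable def rmRadius (t r m : ℕ) : ℕ :=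
  genCoveringRadius t (reedMuller r m)

/-- The binary entropy function `H₂` with logarithms to base `2`
(`Real.binEntropy` uses natural logarithms). -/
noncomputable def binEntropyTwo (p : ℝ) : ℝ :=
  Real.binEntropy p / Real.log 2

/-! Upper bound. The `(u, u + v)` construction makes the radius subadditive, in the same pattern as
Pascal's rule, so a saving of `√(2^t - 1) / 2^t * m.choose r` propagates by induction once it holds
for `r = m` and `r = 1` (`rmRadius_le_choose`). For `r = 1`, the number of columns where a random
codeword matrix agrees with the target has the mean and variance of a binomial variable, and a
nonnegative third central moment, because affine functions separate a point from two others. Hence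
some choice exceeds the mean by a full standard deviation (`exists_codeword_agreement`). A sharp
form of Stirling's formula turns the binomial coefficient into entropy.

Lower bound. This is sphere covering with ball sizes estimated by an exponential moment
(`one_le_of_covering`). The code has at most `2^(2^(m H₂(α)))` words; a second-order expansion of
the moment and the optimal exponent give the main term, with relative error of order `2^(-m (1 -
H₂(α)) / 2)`. -/

theorem genCoveringRadius_le {F ι : Type*} [Field F] [DecidableEq F] [Fintype ι] {t : ℕ}
    {C : Submodule F (ι → F)} {r : ℕ}
    (h : ∀ v : Fin t → ι → F, ∃ c : Fin t → ι → F, (∀ i, c i ∈ C) ∧ tDist c v ≤ r) :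
    genCoveringRadius t C ≤ r :=
  Nat.sInf_le h

theorem genCoveringRadius_top {F ι : Type*} [Field F] [DecidableEq F] [Fintype ι] (t : ℕ) :
    genCoveringRadius t (⊤ : Submodule F (ι → F)) = 0 :=
  Nat.le_zero.1 <| genCoveringRadius_le fun v => ⟨v, fun _ => trivial, by simp [tDist, tWeight]⟩

theorem sum_fin_succ_zmod_two {M : Type*} [AddCommMonoid M] {m : ℕ}
    (f : (Fin (m + 1) → ZMod 2) → M) :
    ∑ y, f y = ∑ x : Fin m → ZMod 2, f (Fin.cons 0 x) + ∑ x : Fin m → ZMod 2, f (Fin.cons 1 x) := by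
  rw [← (Fin.consEquiv fun _ => ZMod 2).sum_comp, Fintype.sum_prod_type]
  exact Fin.sum_univ_two (fun a : Fin 2 => ∑ x : Fin m → ZMod 2, f (Fin.cons (α := fun _ => ZMod 2) a x))

theorem tWeight_eq_sum {F ι : Type*} [Field F] [DecidableEq F] [Fintype ι] {t : ℕ}
    (v : Fin t → ι → F) : tWeight v = ∑ j, if ∃ i, v i j ≠ 0 then 1 else 0 := by
  rw [tWeight, Finset.card_filter]

/-- Approximate the first half of the target by `u`, then approximate the second half minus `u` by
`w`; the errors in the two halves add. -/
theorem genCoveringRadius_uuvCode_le (t : ℕ) {m : ℕ}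
    (C₁ C₂ : Submodule (ZMod 2) ((Fin m → ZMod 2) → ZMod 2)) :
    genCoveringRadius t (uuvCode C₁ C₂) ≤ genCoveringRadius t C₁ + genCoveringRadius t C₂ := by
  refine genCoveringRadius_le fun v => ?_
  obtain ⟨u, hu, hu'⟩ := genCoveringRadius_spec t C₁ fun i x => v i (Fin.cons 0 x)
  obtain ⟨w, hw, hw'⟩ := genCoveringRadius_spec t C₂ fun i x => v i (Fin.cons 1 x) - u i x
  refine ⟨fun i y => if y 0 = 0 then u i (Fin.tail y) else u i (Fin.tail y) + w i (Fin.tail y),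
    fun i => ⟨u i, hu i, w i, hw i, fun x => by simp⟩, ?_⟩
  refine le_trans (le_of_eq ?_) (add_le_add hu' hw')
  simp only [tDist, tWeight_eq_sum]
  rw [sum_fin_succ_zmod_two]
  refine congrArg₂ _ (Finset.sum_congr rfl fun x _ => ?_) (Finset.sum_congr rfl fun x _ => ?_)
  · simp
  · have (i : Fin t) : u i x + w i x - v i (Fin.cons 1 x) = w i x - (v i (Fin.cons 1 x) - u i x) := by
      ring
    simp [this]

/-! ### Recursion for Reed–Muller codes, and the affine functions they contain -/

theorem reedMuller_zero (m : ℕ) : reedMuller 0 m = Submodule.span (ZMod 2) {1} := by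
  cases m <;> rfl

theorem reedMuller_of_le {r m : ℕ} (hr : 1 ≤ r) (h : m ≤ r) : reedMuller r m = ⊤ := by
  obtain ⟨r, rfl⟩ := Nat.exists_eq_add_of_le' hr
  cases m with
  | zero => rfl
  | succ m => rw [reedMuller, if_pos (by omega)]

theorem reedMuller_succ_succ {r m : ℕ} (h : r < m) :
    reedMuller (r + 1) (m + 1) = uuvCode (reedMuller (r + 1) m) (reedMuller r m) := by
  rw [reedMuller, if_neg (by omega)]

theorem const_mem_reedMuller (a : ZMod 2) (r m : ℕ) :
    (fun _ => a : (Fin m → ZMod 2) → ZMod 2) ∈ reedMuller r m := by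
  induction m generalizing r with
  | zero =>
    cases r with
    | zero =>
      rw [reedMuller_zero]
      convert! Submodule.smul_mem _ a (Submodule.mem_span_singleton_self _)
      simp
    | succ r => rw [reedMuller_of_le (by omega) (by omega)]; trivial
  | succ m ih =>
    cases r with
    | zero =>
      rw [reedMuller_zero]
      convert! Submodule.smul_mem _ a (Submodule.mem_span_singleton_self _)
      simp
    | succ r =>
      by_cases h : r < m
      · rw [reedMuller_succ_succ h]
        exact ⟨_, ih (r + 1), 0, Submodule.zero_mem _, fun x => by simp⟩
      · rw [reedMuller_of_le (by omega) (by omega)]; trivial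

theorem coord_mem_reedMuller {m : ℕ} (i : Fin m) :
    (fun x => x i : (Fin m → ZMod 2) → ZMod 2) ∈ reedMuller 1 m := by
  induction m with
  | zero => exact i.elim0
  | succ m ih =>
    by_cases h : 0 < m
    · rw [reedMuller_succ_succ h]
      refine Fin.cases ?_ (fun j => ?_) i
      · exact ⟨0, Submodule.zero_mem _, _, const_mem_reedMuller 1 0 m, fun x => by simp⟩
      · exact ⟨_, ih j, 0, Submodule.zero_mem _, fun x => by simp⟩
    · rw [reedMuller_of_le (by omega) (by omega)]; trivial

/-! ### First-order codes: three moments of the agreement count -/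

theorem exists_mem_reedMuller_one_separating {m : ℕ} {x y z : Fin m → ZMod 2}
    (hy : x ≠ y) (hz : x ≠ z) :
    ∃ l ∈ reedMuller 1 m, l x = 1 ∧ l y = 0 ∧ l z = 0 := by
  have key : ∀ a b : ZMod 2, a ≠ b → a + b = 1 := by decide
  have two : ∀ a : ZMod 2, a + a = 0 := by decide
  obtain ⟨i, hi⟩ := Function.ne_iff.1 hy
  obtain ⟨j, hj⟩ := Function.ne_iff.1 hz
  have one (k : Fin m) (h1 : x k ≠ y k) (h2 : x k ≠ z k) :
      ∃ l ∈ reedMuller 1 m, l x = 1 ∧ l y = 0 ∧ l z = 0 := by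
    refine ⟨_, Submodule.add_mem _ (coord_mem_reedMuller k) (const_mem_reedMuller (y k) 1 m),
      key _ _ h1, two _, ?_⟩
    have : ∀ a b c : ZMod 2, a ≠ b → a ≠ c → c + b = 0 := by decide
    exact this _ _ _ h1 h2
  by_cases h1 : x i = z i
  · by_cases h2 : x j = y j
    -- Here `y` differs from `x` at `i` but not at `j`, and `z` at `j` but not at `i`, so the sum of
    -- the two coordinates changes at both points.
    · refine ⟨_, Submodule.add_mem _ (Submodule.add_mem _ (coord_mem_reedMuller i)
        (coord_mem_reedMuller j)) (const_mem_reedMuller (x i + x j + 1) 1 m), ?_, ?_, ?_⟩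
      · have : ∀ a b : ZMod 2, a + b + (a + b + 1) = 1 := by decide
        exact this _ _
      · have : ∀ a b c d : ZMod 2, a ≠ b → c = d → b + d + (a + c + 1) = 0 := by decide
        exact this _ _ _ _ hi h2
      · have : ∀ a b c d : ZMod 2, a = b → c ≠ d → b + d + (a + c + 1) = 0 := by decide
        exact this _ _ _ _ h1 hj
    · exact one j h2 hj
  · exact one i hi h1

/-- A code whose dual has minimum distance at least `4` contains, for every target matrix, a matrix
agreeing with it in at least one standard deviation more columns than expected. -/
theorem exists_codeword_agreement {ι : Type*} [Fintype ι]
    (C : Submodule (ZMod 2) (ι → ZMod 2)) (hC₁ : ∀ x, ∃ l ∈ C, l x = 1)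
    (hC : ∀ x y z, x ≠ y → x ≠ z → ∃ l ∈ C, l x = 1 ∧ l y = 0 ∧ l z = 0)
    {t : ℕ} (v : Fin t → ι → ZMod 2) {p : ℝ} (hp : p = 1 / 2 ^ t) (hp₂ : p ≤ 1 / 2) :
    ∃ c : Fin t → ι → ZMod 2, (∀ i, c i ∈ C) ∧
      Fintype.card ι * p + √(Fintype.card ι * (p * (1 - p))) ≤
        ((Finset.univ.filter fun x => ∀ i, c i x = v i x).card : ℝ) := by
  classical
  have hp₀ : 0 < p := by rw [hp]; positivity
  let g : ι → (Fin t → C) → ℝ := fun x c => (if ∀ i, (c i : ι → ZMod 2) x = v i x then 1 else 0) - p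
  -- Translating the rows by multiples of `l` runs column `x` once through all `2^t` values, so the
  -- centered indicator `g x` averages to zero against anything these translations fix.
  have shift (x : ι) (l : ι → ZMod 2) (hl : l ∈ C) (hx : l x = 1) (φ : (Fin t → C) → ℝ)
      (hφ : ∀ (w : Fin t → ZMod 2) c, φ (c + fun i => w i • ⟨l, hl⟩) = φ c) :
      ∑ c, g x c * φ c = 0 := by
    have h1 (w : Fin t → ZMod 2) :
        ∑ c, g x c * φ c = ∑ c, g x (c + fun i => w i • ⟨l, hl⟩) * φ c := by
      rw [← Equiv.sum_comp (Equiv.addRight (fun i => w i • (⟨l, hl⟩ : C)))]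
      exact Finset.sum_congr rfl fun c _ => by rw [Equiv.coe_addRight, hφ]
    have h2 (c : Fin t → C) : ∑ w : Fin t → ZMod 2, g x (c + fun i => w i • ⟨l, hl⟩) = 0 := by
      have h3 (w : Fin t → ZMod 2) : (∀ i, ((c + fun i => w i • (⟨l, hl⟩ : C)) i : ι → ZMod 2) x = v i x) ↔
          w = fun i => v i x - (c i : ι → ZMod 2) x := by
        rw [funext_iff]
        refine forall_congr' fun i => ?_
        simp [hx, eq_sub_iff_add_eq, add_comm]
      simp only [g, h3, Finset.sum_sub_distrib]
      simp [hp]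
    have h4 : ∑ w : Fin t → ZMod 2, ∑ c, g x c * φ c = 0 := by
      rw [Finset.sum_congr rfl fun w _ => h1 w, Finset.sum_comm]
      refine Finset.sum_eq_zero fun c _ => ?_
      rw [← Finset.sum_mul, h2, zero_mul]
    simpa using h4
  have mean (x : ι) : ∑ c, g x c = 0 := by
    obtain ⟨l, hl, hx⟩ := hC₁ x
    simpa using shift x l hl hx (fun _ => 1) (fun _ _ => rfl)
  have off (x y z : ι) (hy : x ≠ y) (hz : x ≠ z) : ∑ c, g x c * (g y c * g z c) = 0 := by
    obtain ⟨l, hl, hx, hy, hz⟩ := hC x y z hy hz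
    refine shift x l hl hx _ fun w c => ?_
    simp [g, hy, hz]
  have off₂ (x y : ι) (hy : x ≠ y) : ∑ c, g x c * g y c = 0 := by
    obtain ⟨l, hl, hx, hy, hz⟩ := hC x y y hy hy
    refine shift x l hl hx _ fun w c => ?_
    simp [g, hy]
  have sq (x : ι) (c : Fin t → C) : g x c ^ 2 = (1 - 2 * p) * g x c + p * (1 - p) := by
    simp only [g]; split_ifs <;> ring
  set N : ℝ := (Fintype.card (Fin t → C) : ℝ) with hN
  have hN₀ : 0 < N := by rw [hN]; exact_mod_cast Fintype.card_pos
  have diag₂ (x : ι) : ∑ c, g x c ^ 2 = N * (p * (1 - p)) := by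
    simp only [sq, Finset.sum_add_distrib, ← Finset.mul_sum, mean]
    rw [Finset.sum_const, Finset.card_univ, nsmul_eq_mul, mul_zero, zero_add]
    ring
  have diag₃ (x : ι) : 0 ≤ ∑ c, g x c * (g x c * g x c) := by
    have (c : Fin t → C) : g x c * (g x c * g x c) = (1 - 2 * p) * g x c ^ 2 + p * (1 - p) * g x c := by
      linear_combination g x c * sq x c
    simp only [this, Finset.sum_add_distrib, ← Finset.mul_sum, mean, diag₂]
    have : 0 ≤ 1 - 2 * p := by linarith
    have : 0 ≤ 1 - p := by linarith
    positivity
  let X : (Fin t → C) → ℝ := fun c => ∑ x, g x c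
  have m1 : ∑ c, X c = 0 := by
    simp only [X]; rw [Finset.sum_comm]; exact Finset.sum_eq_zero fun x _ => mean x
  set σ := √(Fintype.card ι * (p * (1 - p))) with hσ
  have hσ₂ : σ ^ 2 = Fintype.card ι * (p * (1 - p)) := Real.sq_sqrt (by
    have : 0 ≤ 1 - p := by linarith
    positivity)
  have m2 : ∑ c, X c ^ 2 = N * σ ^ 2 := by
    simp only [X, pow_two (∑ x, _), Finset.sum_mul_sum]
    rw [Finset.sum_comm]
    have (x : ι) : ∑ c, ∑ y, g x c * g y c = N * (p * (1 - p)) := by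
      rw [Finset.sum_comm, Finset.sum_eq_single x (fun y _ hy => off₂ x y hy.symm) (by simp),
        ← diag₂ x]
      simp only [pow_two]
    simp only [this, hσ₂, Finset.sum_const, Finset.card_univ, nsmul_eq_mul]
    ring
  have m3 : 0 ≤ ∑ c, X c * (X c * X c) := by
    simp only [X, Finset.sum_mul_sum]
    rw [Finset.sum_comm]
    refine Finset.sum_nonneg fun x _ => ?_
    simp only [Finset.mul_sum]
    rw [Finset.sum_comm]
    refine Finset.sum_nonneg fun y _ => ?_
    rw [Finset.sum_comm]
    refine Finset.sum_nonneg fun z _ => ?_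
    by_cases hxy : x = y
    · subst hxy
      by_cases hxz : x = z
      · subst hxz; exact diag₃ x
      · refine (off z x x (Ne.symm hxz) (Ne.symm hxz)).symm.le.trans_eq ?_
        exact Finset.sum_congr rfl fun c _ => by ring
    · by_cases hxz : x = z
      · subst hxz
        refine (off y x x (Ne.symm hxy) (Ne.symm hxy)).symm.le.trans_eq ?_
        exact Finset.sum_congr rfl fun c _ => by ring
      · exact (off x y z hxy hxz).symm.le
  obtain ⟨c, hc⟩ : ∃ c, σ ≤ X c := by
    by_contra! h
    -- The cubic is nonnegative for `X ≤ σ`, while mean `0`, variance `σ²` and nonnegative third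
    -- moment make its average nonpositive. So `X` would be constantly `-σ`, contradicting mean
    -- zero.
    have hs : ∑ c, (σ - X c) * (X c + σ) ^ 2 ≤ 0 := by
      have (c : Fin t → C) : (σ - X c) * (X c + σ) ^ 2 =
          σ ^ 3 + σ ^ 2 * X c - σ * X c ^ 2 - X c * (X c * X c) := by ring
      simp only [this, Finset.sum_sub_distrib, Finset.sum_add_distrib, ← Finset.mul_sum, m1, m2]
      simp only [Finset.sum_const, Finset.card_univ, nsmul_eq_mul, ← hN]
      linarith
    have hnn : ∀ c ∈ Finset.univ, 0 ≤ (σ - X c) * (X c + σ) ^ 2 := fun c _ =>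
      mul_nonneg (sub_nonneg.2 (h c).le) (sq_nonneg _)
    have hz := (Finset.sum_eq_zero_iff_of_nonneg hnn).1 (le_antisymm hs (Finset.sum_nonneg hnn))
    have hX (c : Fin t → C) : X c = -σ := by
      rcases mul_eq_zero.1 (hz c (Finset.mem_univ c)) with h' | h'
      · exact absurd (sub_eq_zero.1 h') (h c).ne'
      · exact eq_neg_of_add_eq_zero_left (pow_eq_zero_iff two_ne_zero |>.1 h')
    have hs0 : σ = 0 := by
      simp only [hX, Finset.sum_const, Finset.card_univ, nsmul_eq_mul, ← hN] at m1
      rcases mul_eq_zero.1 m1 with h' | h'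
      · exact absurd h' hN₀.ne'
      · linarith
    have := h 0
    rw [hX, hs0] at this
    simp at this
  refine ⟨fun i => c i, fun i => (c i).2, ?_⟩
  have : X c = ((Finset.univ.filter fun x => ∀ i, (c i : ι → ZMod 2) x = v i x).card : ℝ)
      - Fintype.card ι * p := by
    simp only [X, g, Finset.sum_sub_distrib, Finset.sum_const, Finset.card_univ, nsmul_eq_mul,
      Finset.card_filter]
    push_cast
    rfl
  linarith

theorem tDist_add_card_agreement {F ι : Type*} [Field F] [DecidableEq F] [Fintype ι] {t : ℕ}
    (c v : Fin t → ι → F) :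
    tDist c v + (Finset.univ.filter fun x => ∀ i, c i x = v i x).card = Fintype.card ι := by
  classical
  rw [tDist, tWeight, ← Finset.card_univ, ← Finset.card_filter_add_card_filter_not
    (s := Finset.univ) (fun j => ∃ i, (c - v) i j ≠ 0)]
  congr 2
  ext x
  simp [sub_eq_zero]

theorem genCoveringRadius_reedMuller_one_le {t m : ℕ} (ht : 1 ≤ t) {p : ℝ} (hp : p = 1 / 2 ^ t) :
    (rmRadius t 1 m : ℝ) ≤ 2 ^ m * (1 - p) - √(2 ^ m * (p * (1 - p))) := by
  have hp₂ : p ≤ 1 / 2 := by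
    rw [hp]
    exact one_div_le_one_div_of_le two_pos (le_self_pow₀ one_le_two (by omega))
  have hcard : (Fintype.card (Fin m → ZMod 2) : ℝ) = 2 ^ m := by simp
  have key (v : Fin t → (Fin m → ZMod 2) → ZMod 2) :
      ∃ c : Fin t → (Fin m → ZMod 2) → ZMod 2, (∀ i, c i ∈ reedMuller 1 m) ∧
      (tDist c v : ℝ) ≤ 2 ^ m * (1 - p) - √(2 ^ m * (p * (1 - p))) := by
    obtain ⟨c, hc, h⟩ := exists_codeword_agreement (reedMuller 1 m)
      (fun x => ⟨_, const_mem_reedMuller 1 1 m, rfl⟩)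
      (fun x y z => exists_mem_reedMuller_one_separating) v hp hp₂
    refine ⟨c, hc, ?_⟩
    have h2 := congrArg (Nat.cast (R := ℝ)) (tDist_add_card_agreement c v)
    rw [hcard] at h
    rw [Nat.cast_add, hcard] at h2
    linarith
  have h0 : 0 ≤ 2 ^ m * (1 - p) - √(2 ^ m * (p * (1 - p))) := by
    obtain ⟨c, -, h⟩ := key 0
    exact (Nat.cast_nonneg _).trans h
  have : rmRadius t 1 m ≤ ⌊2 ^ m * (1 - p) - √(2 ^ m * (p * (1 - p)))⌋₊ :=
    genCoveringRadius_le fun v => by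
      obtain ⟨c, hc, h⟩ := key v
      exact ⟨c, hc, Nat.le_floor h⟩
  exact (Nat.cast_le.2 this).trans (Nat.floor_le h0)

theorem sq_le_two_pow {m : ℕ} (hm : m ≠ 3) : m ^ 2 ≤ 2 ^ m := by
  rcases lt_or_ge m 4 with h | h
  · interval_cases m <;> simp_all
  · induction m, h using Nat.le_induction with
    | base => norm_num
    | succ n hn ih =>
      have := ih (by omega)
      rw [pow_succ 2 n]
      nlinarith

theorem rmRadius_one_le {t m : ℕ} (ht : 1 ≤ t) :
    (rmRadius t 1 m : ℝ) ≤ (1 - 1 / 2 ^ t) * 2 ^ m - √(2 ^ t - 1) / 2 ^ t * √(2 ^ m) := by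
  have h := genCoveringRadius_reedMuller_one_le (m := m) ht rfl
  have : √(2 ^ m * (1 / 2 ^ t * (1 - 1 / 2 ^ t))) = √(2 ^ t - 1) / 2 ^ t * √(2 ^ m : ℝ) := by
    have : (2 ^ m * (1 / 2 ^ t * (1 - 1 / 2 ^ t)) : ℝ) = 2 ^ m * ((2 ^ t - 1) / (2 ^ t) ^ 2) := by
      field_simp
    rw [this, Real.sqrt_mul (by positivity), Real.sqrt_div' _ (by positivity),
      Real.sqrt_sq (by positivity), mul_comm]
  rw [this] at h
  linarith

/-- The one case where `m > √(2^m)`, so the moment bound alone is too weak. Rounding it down to an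
integer closes the gap; for `t ≥ 5` it suffices that the radius is at most `7`. -/
theorem rmRadius_one_three_le {t : ℕ} (ht : 1 ≤ t) :
    (rmRadius t 1 3 : ℝ) ≤ (1 - 1 / 2 ^ t) * 2 ^ 3 - √(2 ^ t - 1) / 2 ^ t * 3 := by
  have h := rmRadius_one_le (m := 3) ht
  have h8 : (2.8 : ℝ) ≤ √(2 ^ 3) := Real.le_sqrt_of_sq_le (by norm_num)
  have of_lt (K : ℝ) (k : ℕ) (hK : K = k) (hk : (rmRadius t 1 3 : ℝ) < K + 1) :
      (rmRadius t 1 3 : ℝ) ≤ K := by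
    subst hK
    have : rmRadius t 1 3 < k + 1 := by exact_mod_cast hk
    exact_mod_cast Nat.lt_succ_iff.1 this
  generalize (rmRadius t 1 3 : ℝ) = R at h of_lt ⊢
  rcases lt_or_ge t 5 with h5 | h5
  · interval_cases t
    · norm_num at h ⊢
      have := of_lt 2 2 (by norm_num) (by norm_num at h8; linarith)
      linarith
    · have s1 : (1.7 : ℝ) ≤ √3 := Real.le_sqrt_of_sq_le (by norm_num)
      have s2 : √3 ≤ (1.74 : ℝ) := Real.sqrt_le_iff.2 (by norm_num)
      norm_num at h h8 ⊢
      have := of_lt 4 4 (by norm_num) (by nlinarith)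
      linarith
    · have s1 : (1 : ℝ) ≤ √7 := Real.le_sqrt_of_sq_le (by norm_num)
      have s2 : √7 ≤ (2.65 : ℝ) := Real.sqrt_le_iff.2 (by norm_num)
      norm_num at h h8 ⊢
      have := of_lt 6 6 (by norm_num) (by nlinarith)
      linarith
    · have s1 : (3.8 : ℝ) ≤ √15 := Real.le_sqrt_of_sq_le (by norm_num)
      have s2 : √15 ≤ (3.9 : ℝ) := Real.sqrt_le_iff.2 (by norm_num)
      norm_num at h h8 ⊢
      have := of_lt 6 6 (by norm_num) (by nlinarith)
      linarith
  · have hQ : (32 : ℝ) ≤ 2 ^ t := by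
      calc (32 : ℝ) = 2 ^ 5 := by norm_num
        _ ≤ 2 ^ t := pow_le_pow_right₀ one_le_two h5
    generalize (2 : ℝ) ^ t = Q at *
    have hs : (5 : ℝ) ≤ √(Q - 1) := Real.le_sqrt_of_sq_le (by linarith)
    have hs2 : √(Q - 1) ^ 2 = Q - 1 := Real.sq_sqrt (by linarith)
    have := of_lt 7 7 (by norm_num) (by
      have : 0 ≤ √(Q - 1) / Q * √(2 ^ 3) := by positivity
      have : 0 < 1 / Q := by positivity
      linarith [show (1 - 1 / Q) * 2 ^ 3 = 8 - 8 * (1 / Q) by ring])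
    refine this.trans ?_
    have : (1 - 1 / Q) * 2 ^ 3 - √(Q - 1) / Q * 3 - 7 = (Q - 8 - 3 * √(Q - 1)) / Q := by
      field_simp; ring
    have : 0 ≤ (Q - 8 - 3 * √(Q - 1)) / Q := div_nonneg (by nlinarith) (by linarith)
    linarith

/-! ### Induction along Pascal's rule -/

theorem rmRadius_le_choose {t : ℕ} (ht : 1 ≤ t) (m r : ℕ) (hr : 1 ≤ r) (hrm : r ≤ m) :
    (rmRadius t r m : ℝ) ≤
      (1 - 1 / 2 ^ t) * 2 ^ m - √(2 ^ t - 1) / 2 ^ t * (m.choose r : ℝ) := by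
  have hQ : (2 : ℝ) ≤ 2 ^ t := le_self_pow₀ one_le_two (by omega)
  induction m generalizing r with
  | zero => omega
  | succ m ih =>
    rcases hrm.eq_or_lt with rfl | hlt
    · rw [rmRadius, reedMuller_of_le hr le_rfl, genCoveringRadius_top]
      have h1 : √(2 ^ t - 1) ≤ (2 : ℝ) ^ t - 1 := Real.sqrt_le_iff.2 ⟨by linarith, by nlinarith⟩
      have h2 : (1 : ℝ) ≤ 2 ^ (m + 1) := one_le_pow₀ one_le_two
      rw [Nat.choose_self]
      have : (1 - 1 / 2 ^ t) * (2 : ℝ) ^ (m + 1) - √(2 ^ t - 1) / 2 ^ t * ((1 : ℕ) : ℝ) =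
          ((2 ^ t - 1) * 2 ^ (m + 1) - √(2 ^ t - 1)) / 2 ^ t := by
        push_cast; field_simp
      rw [this, Nat.cast_zero]
      exact div_nonneg (by nlinarith) (by positivity)
    · rcases hr.eq_or_lt with rfl | hr'
      · by_cases h3 : m + 1 = 3
        · rw [h3, Nat.choose_one_right]; exact_mod_cast rmRadius_one_three_le ht
        · refine (rmRadius_one_le ht).trans ?_
          rw [Nat.choose_one_right]
          have : ((m + 1 : ℕ) : ℝ) ≤ √(2 ^ (m + 1)) :=
            Real.le_sqrt_of_sq_le (by exact_mod_cast sq_le_two_pow h3)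
          have : √(2 ^ t - 1) / 2 ^ t * ((m + 1 : ℕ) : ℝ) ≤
            √(2 ^ t - 1) / 2 ^ t * √(2 ^ (m + 1)) := by gcongr
          linarith
      · obtain ⟨k, rfl⟩ := Nat.exists_eq_add_of_le' hr
        have h1 := ih (k + 1) (by omega) (by omega)
        have h2 := ih k (by omega) (by omega)
        have h3 : (rmRadius t (k + 1) (m + 1) : ℝ) ≤ rmRadius t (k + 1) m + rmRadius t k m := by
          have : rmRadius t (k + 1) (m + 1) ≤ rmRadius t (k + 1) m + rmRadius t k m := by
            rw [rmRadius, reedMuller_succ_succ (by omega)]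
            exact genCoveringRadius_uuvCode_le _ _ _
          exact_mod_cast this
        rw [Nat.choose_succ_succ, pow_succ]
        push_cast
        linarith

/-! ### Binomial coefficients and entropy -/

/-- The source of the constant `8` in the binomial bound, sharp at `r = s = 1`. The sequence
decreases to `√π`, so comparing the left side with `2√π` settles all but the smallest pairs. -/
theorem stirlingSeq_mul_stirlingSeq_le {r s : ℕ} (hr : 1 ≤ r) (hs : 1 ≤ s) :
    Stirling.stirlingSeq r * Stirling.stirlingSeq s ≤ 2 * Stirling.stirlingSeq (r + s) := by
  wlog hrs : r ≤ s generalizing r s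
  · rw [mul_comm, add_comm r s]; exact this hs hr (by omega)
  have anti {a b : ℕ} (ha : 1 ≤ a) (hab : a ≤ b) :
      Stirling.stirlingSeq b ≤ Stirling.stirlingSeq a := by
    have := Stirling.stirlingSeq'_antitone (a := a - 1) (b := b - 1) (by omega)
    simpa [Nat.sub_add_cancel ha, Nat.sub_add_cancel (ha.trans hab)] using this
  have pos {a : ℕ} (ha : 1 ≤ a) : 0 ≤ Stirling.stirlingSeq a := by
    have := (Stirling.stirlingSeq'_pos (a - 1)).le
    rwa [Nat.sub_add_cancel ha] at this
  have pi_le : (1.772 : ℝ) ≤ √Real.pi :=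
    Real.le_sqrt_of_sq_le (by nlinarith [Real.pi_gt_d4])
  have lim := pi_le.trans (Stirling.sqrt_pi_le_stirlingSeq (n := r + s) (by omega))
  have hs2 : √2 ^ 2 = (2 : ℝ) := Real.sq_sqrt (by norm_num)
  have h2l : (1.41421 : ℝ) ≤ √2 := Real.le_sqrt_of_sq_le (by norm_num)
  have he := Real.exp_one_lt_d9
  have he' := Real.exp_one_gt_d9
  have v1 : Stirling.stirlingSeq 1 = Real.exp 1 / √2 := Stirling.stirlingSeq_one
  have v2 : Stirling.stirlingSeq 2 = Real.exp 1 ^ 2 / 4 := by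
    have : √((2 : ℝ) * 2) = 2 := by rw [Real.sqrt_mul_self]; norm_num
    simp [Stirling.stirlingSeq, this]
    field_simp
    norm_num [Nat.factorial]
    ring
  have v3 : Stirling.stirlingSeq 3 = 2 * Real.exp 1 ^ 3 / (9 * √6) := by
    have : (2 : ℝ) * 3 = 6 := by norm_num
    simp [Stirling.stirlingSeq, this]
    field_simp
    norm_num [Nat.factorial]
    ring
  have b1 : Stirling.stirlingSeq 1 ≤ 1.92213 := by
    rw [v1, div_le_iff₀ (by positivity)]; linarith
  have e2 : Real.exp 1 ^ 2 ≤ 7.38906 := by nlinarith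
  have b2 : Stirling.stirlingSeq 2 ≤ 1.84727 := by
    rw [v2]; linarith
  have h6u : √6 ≤ (2.4495 : ℝ) := Real.sqrt_le_iff.2 (by norm_num)
  have h6l : (2.4494 : ℝ) ≤ √6 := Real.le_sqrt_of_sq_le (by norm_num)
  have e3 : Real.exp 1 ^ 3 ≤ 20.0856 := by nlinarith
  have e3' : (20.0855 : ℝ) ≤ Real.exp 1 ^ 3 := by
    have : (7.389056 : ℝ) ≤ Real.exp 1 ^ 2 := by nlinarith
    nlinarith
  have b3 : Stirling.stirlingSeq 3 ≤ 1.8224 := by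
    rw [v3, div_le_iff₀ (by positivity)]; linarith
  have b3' : 1.822 ≤ Stirling.stirlingSeq 3 := by
    rw [v3, le_div_iff₀ (by positivity)]; linarith
  rcases Nat.lt_or_ge 1 r with h | h
  · have h1 := (anti (a := 2) (by omega) h).trans b2
    have h2 := (anti (a := 2) (by omega) (by omega : 2 ≤ s)).trans b2
    nlinarith [mul_le_mul h1 h2 (pos hs) (by norm_num)]
  · obtain rfl : r = 1 := by omega
    rcases Nat.lt_or_ge 2 s with h' | h'
    · have h2 := (anti (a := 3) (by omega) h').trans b3
      nlinarith [mul_le_mul b1 h2 (pos hs) (by norm_num)]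
    -- For `(1, 1)` equality holds, and for `(1, 2)` the product slightly exceeds `2√π`; both need
    -- the actual value of the right side.
    · obtain rfl | rfl : s = 1 ∨ s = 2 := by omega
      · norm_num
        rw [v2, div_mul_div_comm, ← pow_two, ← pow_two, hs2]
        linarith
      · norm_num
        nlinarith [mul_le_mul b1 b2 (pos hs) (by norm_num)]

theorem factorial_eq_stirlingSeq_mul {n : ℕ} (hn : n ≠ 0) :
    (n.factorial : ℝ) = Stirling.stirlingSeq n * (√(2 * n) * (n / Real.exp 1) ^ n) := by
  rw [Stirling.stirlingSeq, div_mul_cancel₀]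
  positivity

/-- A lower bound for binomial coefficients coming from Stirling's formula. -/
theorem le_choose_of_stirling {r s : ℕ} (hr : 1 ≤ r) (hs : 1 ≤ s) :
    √((r + s) / (8 * r * s)) * ((r + s) ^ (r + s) / (r ^ r * s ^ s)) ≤
      (((r + s).choose r : ℕ) : ℝ) := by
  have hr0 : (0 : ℝ) < r := by exact_mod_cast hr
  have hs0 : (0 : ℝ) < s := by exact_mod_cast hs
  have hch : (((r + s).choose r : ℕ) : ℝ) * (r.factorial * s.factorial) = (r + s).factorial := by
    have := Nat.choose_mul_factorial_mul_factorial (Nat.le_add_right r s)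
    rw [Nat.add_sub_cancel_left] at this
    rw [← mul_assoc]; exact_mod_cast this
  have hS : 0 < Stirling.stirlingSeq (r + s) := by
    have := Stirling.stirlingSeq'_pos (r + s - 1)
    rwa [Nat.sub_add_cancel (by omega)] at this
  rw [factorial_eq_stirlingSeq_mul (by omega), factorial_eq_stirlingSeq_mul (by omega),
    factorial_eq_stirlingSeq_mul (n := r + s) (by omega)] at hch
  have hle := stirlingSeq_mul_stirlingSeq_le hr hs
  set c : ℝ := (((r + s).choose r : ℕ) : ℝ) with hc
  set P : ℝ := √(2 * r) * (r / Real.exp 1) ^ r * (√(2 * s) * (s / Real.exp 1) ^ s) with hP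
  have h1 : Stirling.stirlingSeq (r + s) * (√(2 * (r + s : ℕ)) * ((r + s : ℕ) / Real.exp 1) ^ (r + s))
      ≤ Stirling.stirlingSeq (r + s) * (c * (2 * P)) := by
    rw [← hch]
    calc _ = c * P * (Stirling.stirlingSeq r * Stirling.stirlingSeq s) := by rw [hP]; ring
      _ ≤ c * P * (2 * Stirling.stirlingSeq (r + s)) := by gcongr
      _ = _ := by ring
  have h2 := le_of_mul_le_mul_left h1 hS
  have h3 : √((r + s) / (8 * r * s) : ℝ) * (√(2 * r) * √(2 * s) * 2) = √(2 * (r + s)) := by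
    rw [show (2 : ℝ) = √4 by rw [show (4 : ℝ) = 2 ^ 2 by norm_num, Real.sqrt_sq (by norm_num)],
      ← Real.sqrt_mul (by positivity), ← Real.sqrt_mul (by positivity),
      ← Real.sqrt_mul (by positivity)]
    rw [show √4 = (2 : ℝ) by rw [show (4 : ℝ) = 2 ^ 2 by norm_num, Real.sqrt_sq (by norm_num)]]
    congr 1
    field_simp
    norm_num
  have hPpos : 0 < 2 * P := by rw [hP]; positivity
  refine le_of_mul_le_mul_right (le_trans (le_of_eq ?_) h2) hPpos
  push_cast
  rw [← h3, hP, div_pow, div_pow, div_pow, pow_add (Real.exp 1)]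
  field_simp

theorem two_rpow_mul_binEntropyTwo {α : ℝ} (h0 : 0 < α) (h1 : α < 1) {m r s : ℕ}
    (hr : (r : ℝ) = α * m) (hs : (s : ℝ) = (1 - α) * m) :
    (2 : ℝ) ^ ((m : ℝ) * binEntropyTwo α) = (α ^ r * (1 - α) ^ s)⁻¹ := by
  have h1' : 0 < 1 - α := by linarith
  have hl : Real.log 2 ≠ 0 := (Real.log_pos one_lt_two).ne'
  rw [Real.rpow_def_of_pos two_pos, ← Real.exp_log (x := (α ^ r * (1 - α) ^ s)⁻¹) (by positivity),
    Real.log_inv, Real.log_mul (by positivity) (by positivity), Real.log_pow, Real.log_pow, hr, hs,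
    binEntropyTwo, Real.binEntropy, Real.log_inv, Real.log_inv]
  congr 1
  field_simp
  ring

theorem entropy_le_choose {α : ℝ} (h0 : 0 < α) (h1 : α ≤ 1 / 2) {m r : ℕ} (hm : 1 ≤ m)
    (hr : (r : ℝ) = α * m) :
    1 ≤ r ∧ r ≤ m ∧ 1 / √(8 * m * α * (1 - α)) * (2 : ℝ) ^ ((m : ℝ) * binEntropyTwo α) ≤
      (m.choose r : ℝ) := by
  have hm0 : (0 : ℝ) < m := by exact_mod_cast hm
  have hr1 : 1 ≤ r := by
    have : (0 : ℝ) < r := by rw [hr]; positivity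
    exact_mod_cast this
  have hrm : r < m := by
    have : (r : ℝ) < m := by rw [hr]; nlinarith
    exact_mod_cast this
  refine ⟨hr1, hrm.le, ?_⟩
  obtain ⟨s, rfl⟩ := Nat.exists_eq_add_of_lt hrm
  have hs : ((s + 1 : ℕ) : ℝ) = (1 - α) * (r + s + 1 : ℕ) := by
    push_cast at hr ⊢; linarith
  rw [two_rpow_mul_binEntropyTwo h0 (by linarith) hr hs]
  have key := le_choose_of_stirling (s := s + 1) hr1 (by omega)
  rw [← add_assoc] at key
  refine le_trans (le_of_eq ?_) key
  set M : ℕ := r + s + 1 with hM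
  have e : (r : ℝ) + (s + 1 : ℕ) = M := by rw [hM]; push_cast; ring
  have h1' : 0 < 1 - α := by linarith
  rw [e, hr, hs]
  congr 1
  · rw [one_div, ← Real.sqrt_inv]
    congr 1
    field_simp
  · rw [mul_pow, mul_pow, hM, add_assoc, pow_add _ r (s + 1)]
    field_simp

/-! ### Sphere covering by exponential moments -/

/-- The weight is a sum over columns, so the sum factors; each column contributes `1` when zero and
`e^(-l)` for each of its `2^t - 1` nonzero values. -/
theorem sum_exp_neg_tWeight {ι : Type*} [Fintype ι] [DecidableEq ι] (t : ℕ) (l : ℝ) :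
    ∑ v : Fin t → ι → ZMod 2, Real.exp (-l * tWeight v) =
      (1 + (2 ^ t - 1) * Real.exp (-l)) ^ Fintype.card ι := by
  have col : ∑ w : Fin t → ZMod 2, (if ∃ i, w i ≠ 0 then Real.exp (-l) else 1) =
      1 + (2 ^ t - 1) * Real.exp (-l) := by
    have h (w : Fin t → ZMod 2) : (if ∃ i, w i ≠ 0 then Real.exp (-l) else 1) =
        Real.exp (-l) + if w = 0 then 1 - Real.exp (-l) else 0 := by
      by_cases hw : w = 0
      · simp [hw]
      · have : ∃ i, w i ≠ 0 := Function.ne_iff.1 hw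
        rw [if_pos this, if_neg hw, add_zero]
    simp only [h, Finset.sum_add_distrib]
    simp
    ring
  rw [← col, ← Finset.card_univ, ← Finset.prod_const, Fintype.prod_sum,
    ← Equiv.sum_comp (Equiv.piComm fun (_ : Fin t) (_ : ι) => ZMod 2)]
  refine Finset.sum_congr rfl fun v _ => ?_
  rw [tWeight, mul_comm, Finset.card_filter, Nat.cast_sum, Finset.sum_mul, Real.exp_sum]
  refine Finset.prod_congr rfl fun j _ => ?_
  simp only [Equiv.piComm_apply, Function.swap]
  split_ifs <;> simp

/-- The exponential-moment form of the sphere-covering bound. -/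
theorem one_le_of_covering {ι : Type*} [Fintype ι] [DecidableEq ι] (t : ℕ)
    (C : Submodule (ZMod 2) (ι → ZMod 2)) {l : ℝ} (hl : 0 ≤ l) :
    (2 ^ t : ℝ) ^ Fintype.card ι ≤ (Nat.card C : ℝ) ^ t *
      (Real.exp (l * genCoveringRadius t C) *
        (1 + (2 ^ t - 1) * Real.exp (-l)) ^ Fintype.card ι) := by
  classical
  set R := genCoveringRadius t C with hR
  have h1 (v : Fin t → ι → ZMod 2) : (1 : ℝ) ≤
      ∑ c : Fin t → C, Real.exp (l * R) * Real.exp (-l * tWeight ((fun i => (c i : ι → ZMod 2)) - v)) := by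
    obtain ⟨c, hc, h⟩ := genCoveringRadius_spec t C v
    refine le_trans ?_ (Finset.single_le_sum (fun c _ => by positivity)
      (Finset.mem_univ (fun i => (⟨c i, hc i⟩ : C))))
    rw [← Real.exp_add, Real.one_le_exp_iff]
    have : (tWeight (c - v) : ℝ) ≤ R := by exact_mod_cast h
    nlinarith
  calc (2 ^ t : ℝ) ^ Fintype.card ι = ∑ v : Fin t → ι → ZMod 2, (1 : ℝ) := by
        simp [← pow_mul, mul_comm]
    _ ≤ ∑ v : Fin t → ι → ZMod 2, ∑ c : Fin t → C,
          Real.exp (l * R) * Real.exp (-l * tWeight ((fun i => (c i : ι → ZMod 2)) - v)) :=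
        Finset.sum_le_sum fun v _ => h1 v
    _ = ∑ c : Fin t → C, Real.exp (l * R) * (1 + (2 ^ t - 1) * Real.exp (-l)) ^ Fintype.card ι := by
        rw [Finset.sum_comm]
        refine Finset.sum_congr rfl fun c _ => ?_
        rw [← Finset.mul_sum, ← sum_exp_neg_tWeight t l,
          ← Equiv.sum_comp (Equiv.subLeft fun i => (c i : ι → ZMod 2))]
        simp only [Equiv.subLeft_apply, sub_sub_cancel]
    _ = _ := by
        rw [Finset.sum_const, Finset.card_univ, nsmul_eq_mul, Fintype.card_fun, Fintype.card_fin,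
          Nat.card_eq_fintype_card]
        push_cast
        rfl

theorem exp_le_one_add_quadratic {x l : ℝ} (hl : l ≤ 1) (hx : |x| ≤ l) :
    Real.exp x ≤ 1 + x + x ^ 2 / 2 * (1 + l) := by
  have h := Real.exp_bound (x := x) (hx.trans hl) (n := 3) (by norm_num)
  have h2 := (abs_le.1 h).2
  simp only [Finset.sum_range_succ, Finset.sum_range_zero] at h2
  norm_num [Nat.factorial] at h2
  have : |x| ^ 3 ≤ l * x ^ 2 := by
    rw [pow_succ', sq_abs]; gcongr
  have : 0 ≤ l * x ^ 2 := mul_nonneg ((abs_nonneg x).trans hx) (sq_nonneg x)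
  linarith

/-- After the mean is factored out, linear terms cancel and quadratic ones add up to the variance `p
(1 - p)`; the factor `1 + l` absorbs the higher orders. -/
theorem centered_bernoulli_mgf_le {p l : ℝ} (hp₀ : 0 ≤ p) (hp₁ : p ≤ 1) (hl₀ : 0 ≤ l) (hl : l ≤ 1) :
    p + (1 - p) * Real.exp (-l) ≤
      Real.exp (-l * (1 - p) + p * (1 - p) * l ^ 2 * (1 + l) / 2) := by
  have h1 : Real.exp (l * (1 - p)) ≤ _ := exp_le_one_add_quadratic (l := l) hl (by
    rw [abs_of_nonneg (mul_nonneg hl₀ (by linarith))]; nlinarith)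
  have h2 : Real.exp (-l * p) ≤ _ := exp_le_one_add_quadratic (l := l) hl (by
    rw [neg_mul, abs_neg, abs_of_nonneg (mul_nonneg hl₀ hp₀)]; nlinarith)
  have e : p + (1 - p) * Real.exp (-l) =
      Real.exp (-l * (1 - p)) * (p * Real.exp (l * (1 - p)) + (1 - p) * Real.exp (-l * p)) := by
    rw [mul_add, mul_left_comm, ← Real.exp_add, mul_left_comm, ← Real.exp_add]
    ring_nf
    rw [Real.exp_zero]
    ring
  rw [e, Real.exp_add]
  gcongr
  have h3 := Real.add_one_le_exp (p * (1 - p) * l ^ 2 * (1 + l) / 2)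
  have hq : 0 ≤ 1 - p := by linarith
  nlinarith [mul_le_mul_of_nonneg_left h1 hp₀, mul_le_mul_of_nonneg_left h2 hq]

/-! ### Size of Reed–Muller codes -/

theorem card_uuvCode_le {m : ℕ} (C₁ C₂ : Submodule (ZMod 2) ((Fin m → ZMod 2) → ZMod 2)) :
    Nat.card (uuvCode C₁ C₂) ≤ Nat.card C₁ * Nat.card C₂ := by
  rw [← Nat.card_prod]
  choose f hf using fun c : uuvCode C₁ C₂ =>
    show ∃ p : C₁ × C₂, ∀ x : Fin m → ZMod 2, c.1 (Fin.cons 0 x) = p.1.1 x ∧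
        c.1 (Fin.cons 1 x) = p.1.1 x + p.2.1 x by
      obtain ⟨c, u, hu, v, hv, h⟩ := c
      exact ⟨(⟨u, hu⟩, ⟨v, hv⟩), h⟩
  refine Nat.card_le_card_of_injective f fun c d hcd => Subtype.ext (funext fun y => ?_)
  rw [← Fin.cons_self_tail y]
  have : y 0 = 0 ∨ y 0 = 1 := (by decide : ∀ a : ZMod 2, a = 0 ∨ a = 1) _
  rcases this with h | h <;> rw [h]
  · rw [(hf c _).1, (hf d _).1, hcd]
  · rw [(hf c _).2, (hf d _).2, hcd]

theorem card_reedMuller_le (r m : ℕ) :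
    Nat.card (reedMuller r m) ≤ 2 ^ ∑ i ∈ Finset.range (r + 1), m.choose i := by
  have top (r m : ℕ) (hr : 1 ≤ r) (h : m ≤ r) :
      Nat.card (reedMuller r m) ≤ 2 ^ ∑ i ∈ Finset.range (r + 1), m.choose i := by
    rw [reedMuller_of_le hr h]
    have h1 : Nat.card (⊤ : Submodule (ZMod 2) ((Fin m → ZMod 2) → ZMod 2)) = 2 ^ 2 ^ m := by
      rw [Nat.card_congr (Submodule.topEquiv (R := ZMod 2)).toEquiv]
      simp
    rw [h1, ← Nat.sum_range_choose m]
    exact Nat.pow_le_pow_right two_pos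
      (Finset.sum_le_sum_of_subset (Finset.range_subset_range.2 (by omega)))
  have zero (m : ℕ) :
      Nat.card (reedMuller 0 m) ≤ 2 ^ ∑ i ∈ Finset.range (0 + 1), m.choose i := by
    rw [reedMuller_zero]
    have : Function.Surjective fun a : ZMod 2 =>
        (⟨a • 1, Submodule.smul_mem _ a (Submodule.mem_span_singleton_self _)⟩ :
          Submodule.span (ZMod 2) {(1 : (Fin m → ZMod 2) → ZMod 2)}) := by
      rintro ⟨c, hc⟩
      obtain ⟨a, rfl⟩ := Submodule.mem_span_singleton.1 hc
      exact ⟨a, rfl⟩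
    simpa using Nat.card_le_card_of_surjective _ this
  induction m generalizing r with
  | zero =>
    rcases Nat.eq_zero_or_pos r with rfl | hr
    · exact zero 0
    · exact top r 0 hr (by omega)
  | succ m ih =>
    rcases Nat.eq_zero_or_pos r with rfl | hr
    · exact zero _
    by_cases h : m + 1 ≤ r
    · exact top r _ hr h
    obtain ⟨k, rfl⟩ := Nat.exists_eq_add_of_le' hr
    rw [reedMuller_succ_succ (by omega)]
    refine (card_uuvCode_le _ _).trans ((Nat.mul_le_mul (ih (k + 1)) (ih k)).trans ?_)
    rw [← pow_add]
    refine Nat.pow_le_pow_right two_pos (le_of_eq ?_)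
    rw [Finset.sum_range_succ' _ (k + 1), Finset.sum_range_succ' _ (k + 1)]
    simp only [Nat.choose_succ_succ, Finset.sum_add_distrib, Nat.choose_zero_right]
    ring

/-- Expand `(α + (1 - α))^m = 1`: since `α ≤ 1 - α`, every term with `i ≤ r` has weight at least
`α^r (1 - α)^(m - r)`, which is `2^(-m H₂(α))`. -/
theorem sum_choose_le_entropy {α : ℝ} (h0 : 0 < α) (h1 : α ≤ 1 / 2) {m r : ℕ}
    (hr : (r : ℝ) = α * m) :
    ((∑ i ∈ Finset.range (r + 1), m.choose i : ℕ) : ℝ) ≤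
      (2 : ℝ) ^ ((m : ℝ) * binEntropyTwo α) := by
  have hrm : r ≤ m := by
    have : (r : ℝ) ≤ m := by rw [hr]; nlinarith [(Nat.cast_nonneg m : (0 : ℝ) ≤ m)]
    exact_mod_cast this
  have hq : 0 < 1 - α := by linarith
  obtain ⟨s, rfl⟩ := Nat.exists_eq_add_of_le hrm
  have hs : (s : ℝ) = (1 - α) * (r + s : ℕ) := by push_cast at hr ⊢; linarith
  rw [two_rpow_mul_binEntropyTwo h0 (by linarith) hr hs, ← one_div, le_div_iff₀ (by positivity)]
  have hb := add_pow α (1 - α) (r + s)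
  rw [add_sub_cancel, one_pow] at hb
  refine le_trans ?_ hb.ge
  rw [Nat.cast_sum, Finset.sum_mul]
  refine (Finset.sum_le_sum fun i hi => ?_).trans (Finset.sum_le_sum_of_subset_of_nonneg
    (Finset.range_subset_range.2 (by omega : r + 1 ≤ r + s + 1)) fun i _ _ => by positivity)
  obtain ⟨k, hk⟩ := Nat.exists_eq_add_of_le (Nat.lt_succ_iff.1 (Finset.mem_range.1 hi))
  rw [mul_comm]
  refine mul_le_mul_of_nonneg_right ?_ (Nat.cast_nonneg _)
  rw [show r + s - i = k + s by omega, hk, pow_add, pow_add, mul_assoc]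
  have : α ^ k ≤ (1 - α) ^ k := pow_le_pow_left₀ h0.le (by linarith) k
  gcongr

/-! ### The lower bound and the conclusion -/

theorem reedMuller_chernoff {t : ℕ} {α : ℝ} (h0 : 0 < α) (h1 : α ≤ 1 / 2) {m r : ℕ}
    (hr : (r : ℝ) = α * m) {l : ℝ} (hl₀ : 0 ≤ l) (hl : l ≤ 1) :
    l * ((1 - 1 / 2 ^ t) * 2 ^ m - rmRadius t r m) ≤
      t * Real.log 2 * (2 : ℝ) ^ ((m : ℝ) * binEntropyTwo α) +
        2 ^ m * ((2 ^ t - 1) / (2 ^ t) ^ 2) * l ^ 2 * (1 + l) / 2 := by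
  set D := (2 : ℝ) ^ ((m : ℝ) * binEntropyTwo α) with hD
  set Q : ℝ := 2 ^ t with hQ
  have hQ1 : 1 ≤ Q := one_le_pow₀ one_le_two
  have hQ0 : 0 < Q := by linarith
  have hlog := Real.log_pos one_lt_two
  have hcov := one_le_of_covering t (reedMuller r m) hl₀
  have hcard : Fintype.card (Fin m → ZMod 2) = 2 ^ m := by simp
  rw [hcard] at hcov
  set R := genCoveringRadius t (reedMuller r m) with hR
  have hC : (Nat.card (reedMuller r m) : ℝ) ≤ Real.exp (D * Real.log 2) := by
    have h2 : (Nat.card (reedMuller r m) : ℝ) ≤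
        (2 : ℝ) ^ (∑ i ∈ Finset.range (r + 1), m.choose i) := by
      exact_mod_cast card_reedMuller_le r m
    refine h2.trans ?_
    rw [← Real.rpow_natCast, Real.rpow_def_of_pos two_pos, Real.exp_le_exp, mul_comm]
    exact mul_le_mul_of_nonneg_right (sum_choose_le_entropy h0 h1 hr) hlog.le
  have hp := centered_bernoulli_mgf_le (p := 1 / Q) (by positivity)
    ((div_le_one hQ0).2 hQ1) hl₀ hl
  have hM : 1 + (Q - 1) * Real.exp (-l) =
      Q * (1 / Q + (1 - 1 / Q) * Real.exp (-l)) := by field_simp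
  have hv : 1 / Q * (1 - 1 / Q) = (Q - 1) / Q ^ 2 := by field_simp
  rw [hv] at hp
  have hE : 0 ≤ 1 / Q + (1 - 1 / Q) * Real.exp (-l) := by
    have : 0 ≤ 1 - 1 / Q := sub_nonneg.2 ((div_le_one hQ0).2 hQ1)
    positivity
  set w := -l * (1 - 1 / Q) + (Q - 1) / Q ^ 2 * l ^ 2 * (1 + l) / 2 with hw
  have hfin : Q ^ 2 ^ m * 1 ≤ Q ^ 2 ^ m *
      Real.exp (t * (D * Real.log 2) + (l * R + ((2 ^ m : ℕ) : ℝ) * w)) := by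
    rw [mul_one]
    refine hcov.trans ?_
    rw [hM, mul_pow, Real.exp_add, Real.exp_add, Real.exp_nat_mul, Real.exp_nat_mul]
    calc _ = Q ^ 2 ^ m * ((Nat.card (reedMuller r m) : ℝ) ^ t * (Real.exp (l * R) *
          (1 / Q + (1 - 1 / Q) * Real.exp (-l)) ^ 2 ^ m)) := by ring
      _ ≤ _ := by gcongr
  have h3 := Real.one_le_exp_iff.1 (le_of_mul_le_mul_left hfin (by positivity))
  have h4 : (rmRadius t r m : ℝ) = R := rfl
  rw [h4]
  rw [hw] at h3
  push_cast at h3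
  linear_combination h3

theorem mainTheorem7 (t : ℕ) (ht : 1 ≤ t) (α : ℝ) (hα₀ : 0 < α) (hα₁ : α ≤ 1 / 2) :
    (∀ m r : ℕ, 1 ≤ m → (r : ℝ) = α * m →
      (rmRadius t r m : ℝ) ≤
        (1 - 1 / (2 : ℝ) ^ t) * (2 : ℝ) ^ m
          - Real.sqrt ((2 : ℝ) ^ t - 1) / (2 : ℝ) ^ t
            * (1 / Real.sqrt (8 * m * α * (1 - α)))
            * (2 : ℝ) ^ ((m : ℝ) * binEntropyTwo α)) ∧
    (α < 1 / 2 →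
      ∃ ε : ℕ → ℝ, Tendsto ε atTop (𝓝 0) ∧
        ∀ m r : ℕ, 1 ≤ m → (r : ℝ) = α * m →
          (1 - 1 / (2 : ℝ) ^ t) * (2 : ℝ) ^ m
            - Real.sqrt (2 * t * ((2 : ℝ) ^ t - 1) * Real.log 2) / (2 : ℝ) ^ t
              * (2 : ℝ) ^ ((m : ℝ) / 2 * (1 + binEntropyTwo α))
              * (1 + ε m)
          ≤ (rmRadius t r m : ℝ)) := by
  have hQ2 : (2 : ℝ) ≤ 2 ^ t := le_self_pow₀ one_le_two (by omega)
  have hlog := Real.log_pos one_lt_two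
  refine ⟨fun m r hm hr => ?_, fun hα => ?_⟩
  · obtain ⟨hr1, hrm, h⟩ := entropy_le_choose hα₀ hα₁ hm hr
    refine (rmRadius_le_choose ht m r hr1 hrm).trans ?_
    rw [mul_assoc (√(2 ^ t - 1) / 2 ^ t)]
    gcongr
  · have hH : binEntropyTwo α < 1 := by
      rw [binEntropyTwo, div_lt_one hlog, Real.binEntropy_lt_log_two]
      exact fun h => by norm_num [h] at hα
    set H := binEntropyTwo α with hHdef
    set v : ℝ := (2 ^ t - 1) / (2 ^ t) ^ 2 with hv
    have hv0 : 0 < v := div_pos (by linarith) (by positivity)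
    have hv1 : v ≤ 1 := (div_le_one (by positivity)).2 (by nlinarith)
    set K : ℝ := Real.sqrt (2 * t * ((2 : ℝ) ^ t - 1) * Real.log 2) / (2 : ℝ) ^ t with hK
    have hK0 : 0 < K := by
      have : (0 : ℝ) < 2 ^ t - 1 := by linarith
      have : (0 : ℝ) < t := by exact_mod_cast ht
      positivity
    have hK2 : K ^ 2 = 2 * t * Real.log 2 * v := by
      have : (0 : ℝ) < 2 ^ t - 1 := by linarith
      rw [hK, div_pow, Real.sq_sqrt (by positivity), hv]
      ring
    let A : ℕ → ℝ := fun m => K * (2 : ℝ) ^ ((m : ℝ) / 2 * (1 + H))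
    have hA0 (m : ℕ) : 0 < A m := by positivity
    have hA2 (m : ℕ) : A m ^ 2 = 2 * t * Real.log 2 * v * 2 ^ m * (2 : ℝ) ^ ((m : ℝ) * H) := by
      rw [mul_pow, hK2, ← Real.rpow_natCast, ← Real.rpow_mul two_pos.le, mul_assoc _ (2 ^ m),
        ← Real.rpow_natCast 2 m, ← Real.rpow_add two_pos]
      push_cast
      ring_nf
    -- The exponent `l = A m / (2^m v)` minimizes the Chernoff bound without its factor `1 + l`,
    -- with optimal value `A m`. The error `l / 2` would do for `l ≤ 1`; the larger `l / v` also
    -- covers `l ≥ 1`.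
    refine ⟨fun m => A m / (2 ^ m * v) / v, ?_, fun m r hm hr => ?_⟩
    · have h1 (m : ℕ) : A m / (2 ^ m * v) / v = K / v ^ 2 * ((2 : ℝ) ^ ((H - 1) / 2)) ^ m := by
        have h2 : (2 : ℝ) ^ ((m : ℝ) / 2 * (1 + H)) = ((2 : ℝ) ^ ((H - 1) / 2)) ^ m * 2 ^ m := by
          rw [← Real.rpow_natCast, ← Real.rpow_natCast, ← Real.rpow_mul two_pos.le,
            ← Real.rpow_add two_pos]
          ring_nf
        simp only [A, h2]
        field_simp
      simp only [h1]
      rw [← mul_zero (K / v ^ 2)]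
      exact (tendsto_pow_atTop_nhds_zero_of_lt_one (by positivity)
        (Real.rpow_lt_one_of_one_lt_of_neg one_lt_two (by linarith))).const_mul _
    · have hA0 := hA0 m
      have hA2 := hA2 m
      change _ - A m * (1 + A m / (2 ^ m * v) / v) ≤ _
      have hn : (0 : ℝ) < 2 ^ m := by positivity
      set n : ℝ := 2 ^ m with hndef
      set l := A m / (n * v) with hl
      have hl0 : 0 < l := by positivity
      have hlA : n * v * l = A m := by rw [hl]; field_simp
      have hlv : l ≤ l / v := by rw [le_div_iff₀ hv0]; nlinarith
      have hR : (0 : ℝ) ≤ rmRadius t r m := Nat.cast_nonneg _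
      rcases le_total l 1 with h | h
      · have key := reedMuller_chernoff (t := t) hα₀ hα₁ hr hl0.le h
        have hL : t * Real.log 2 * (2 : ℝ) ^ ((m : ℝ) * H) = l * A m / 2 := by
          have : n * v * (l * A m) = n * v * (2 * (t * Real.log 2 * (2 : ℝ) ^ ((m : ℝ) * H))) := by
            rw [← mul_assoc, hlA]
            linear_combination hA2
          have := mul_left_cancel₀ (by positivity) this
          linarith
        rw [← hHdef, hL] at key
        have e : l * A m / 2 + n * v * l ^ 2 * (1 + l) / 2 = l * (A m * (1 + l / 2)) := by
          linear_combination l * (1 + l) / 2 * hlA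
        have key2 : l * ((1 - 1 / 2 ^ t) * n - rmRadius t r m) ≤ l * (A m * (1 + l / 2)) :=
          key.trans_eq e
        have := le_of_mul_le_mul_left key2 hl0
        have : A m * (1 + l / 2) ≤ A m * (1 + l / v) := by gcongr; linarith
        linarith
      -- For `l ≥ 1` the error term alone exceeds `n`, so the claimed lower bound is not positive.
      · have h1 : n ≤ A m * (l / v) := by
          rw [← hlA, show n * v * l * (l / v) = n * l ^ 2 by field_simp]
          exact le_mul_of_one_le_right hn.le (one_le_pow₀ h)
        have h2 : (1 - 1 / (2 : ℝ) ^ t) * n ≤ n := by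
          have : 0 ≤ 1 / (2 : ℝ) ^ t := by positivity
          nlinarith
        linarith
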